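/- Let $\mu:P\to M$ be a smooth principal $G$-bundle, where $G$ is a (finite-dimensional, real) Lie group acting on $P$ from the right by $\kappa(p,g)=pg$; write $\kappa_p=\kappa(p,\cdot)$, $\kappa_g=\kappa(\cdot,g)$, and let $T_eG$ be the Lie algebra of $G$. For a manifold $N$, let $Aut_0TN$ be the group of smooth automorphisms of the vector bundle $TN$ covering $\mathrm{id}_N$. Let $Aut_{TG}TP\subset Aut_0TP$ be the subgroup of those $A$ with $A(pg)\circ\Phi_{(g,X)}=\Phi_{(g,X)}\circ A(p)$ for all $p\in P$, $g\in G$, $X\in T_eG$, where $\Phi_{(g,X)}(v_p)=T\kappa_g(p)\bigl(v_p+T\kappa_p(e)X\bigr)$, and let $Aut_NTP\subset Aut_{TG}TP$ be the subgroup of those $A$ for which $A(p)-\mathrm{id}_{T_pP}$ takes values in $\operatorname{Ker}T\mu(p)$ for every $p$. Let $Conn\,P(M,G)$ be the set of connections, i.e. of smooth $T_eG$-valued one-forms $\alpha$ on $P$ with $\alpha_p\circ T\kappa_p(e)=\mathrm{id}_{T_eG}$ and $\alpha_{pg}\circ T\kappa_g(p)=\mathrm{Ad}_{g^{-1}}\circ\alpha_p$.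 For a connection $\alpha$ let $\Gamma_\alpha(p):T_{\mu(p)}M\to\operatorname{Ker}\alpha_p$ be the inverse of the restriction of $T\mu(p)$ to $\operatorname{Ker}\alpha_p$. Let $\lambda:Aut_{TG}TP\to Aut_0TM$ be the group morphism determined by $\lambda(A)(\mu(p))\,T\mu(p)v=T\mu(p)A(p)v$ for $v\in T_pP$, and let $\sigma_\alpha:Aut_0TM\to Aut_{TG}TP$ be the group morphism $\sigma_\alpha(\tilde A)(p)=T\kappa_p(e)\circ\alpha_p+\Gamma_\alpha(p)\circ\tilde A(\mu(p))\circ T\mu(p)$. The group $Aut_{TG}TP$ acts on $Conn\,P(M,G)$ from the left by $\phi_A(\alpha)_p=\alpha_p\circ A(p)^{-1}$. Then: (i) this action of $Aut_{TG}TP$ is transitive: for any connections $\alpha,\alpha'$ there is $A\in Aut_{TG}TP$ with $\phi_A(\alpha)=\alpha'$; (ii) $A(p)\circ\Gamma_\alpha(p)=\Gamma_{\phi_A(\alpha)}(p)\circ\lambda(A)(\mu(p))$ for all connections $\alpha$, all $A\in Aut_{TG}TP$ and all $p\in P$; (iii) the action restricted to the subgroup $Aut_NTP$ is free and transitive (transitivity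 being understood as in (i)); (iv) for every connection $\alpha$, the stabilizer of $\alpha$ in $Aut_{TG}TP$ is the subgroup $\sigma_\alpha(Aut_0TM)$. -/

import Mathlib

open scoped Manifold ContDiff

noncomputable section

section TangentAut

variable (E : Type*) [NormedAddCommGroup E] [NormedSpace ℝ E]
  (M : Type*) [TopologicalSpace M] [ChartedSpace E M] [IsManifold 𝓘(ℝ, E) ∞ M]

/-- A smooth automorphism of the tangent bundle `TM` covering the identity map of `M`: a family of
linear isomorphisms `A x : T_x M → T_x M` such that the induced bijection `TM → TM` and its inverse
are smooth. -/
@[ext]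
structure TangentAut where
  toFun : ∀ x : M, TangentSpace 𝓘(ℝ, E) x ≃ₗ[ℝ] TangentSpace 𝓘(ℝ, E) x
  contMDiff_toFun : ContMDiff 𝓘(ℝ, E).tangent 𝓘(ℝ, E).tangent ∞
    (fun v : TangentBundle 𝓘(ℝ, E) M => (⟨v.1, toFun v.1 v.2⟩ : TangentBundle 𝓘(ℝ, E) M))
  contMDiff_invFun : ContMDiff 𝓘(ℝ, E).tangent 𝓘(ℝ, E).tangent ∞
    (fun v : TangentBundle 𝓘(ℝ, E) M =>
      (⟨v.1, (toFun v.1).symm v.2⟩ : TangentBundle 𝓘(ℝ, E) M))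

namespace TangentAut

variable {E M}

instance : CoeFun (TangentAut E M)
    (fun _ => ∀ x : M, TangentSpace 𝓘(ℝ, E) x ≃ₗ[ℝ] TangentSpace 𝓘(ℝ, E) x) := ⟨toFun⟩

theorem ext_apply {A B : TangentAut E M}
    (h : ∀ (x : M) (v : TangentSpace 𝓘(ℝ, E) x), A x v = B x v) : A = B :=
  TangentAut.ext (funext fun x => LinearEquiv.ext (h x))

/-- The group of automorphisms, the product being composition. -/
instance : Group (TangentAut E M) where
  mul A B := ⟨fun x => (B x).trans (A x), A.contMDiff_toFun.comp B.contMDiff_toFun,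
    B.contMDiff_invFun.comp A.contMDiff_invFun⟩
  one := ⟨fun _ => LinearEquiv.refl ℝ _, contMDiff_id, contMDiff_id⟩
  inv A := ⟨fun x => (A x).symm, A.contMDiff_invFun, A.contMDiff_toFun⟩
  mul_assoc _ _ _ := rfl
  one_mul _ := rfl
  mul_one _ := rfl
  inv_mul_cancel A := ext_apply fun x v => (A x).symm_apply_apply v

theorem mul_apply (A B : TangentAut E M) (x : M) (v : TangentSpace 𝓘(ℝ, E) x) :
    (A * B) x v = A x (B x v) := rfl

theorem one_apply (x : M) (v : TangentSpace 𝓘(ℝ, E) x) : (1 : TangentAut E M) x v = v := rfl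

theorem inv_apply (A : TangentAut E M) (x : M) (v : TangentSpace 𝓘(ℝ, E) x) :
    A⁻¹ x v = (A x).symm v := rfl

theorem apply_inv_apply (A : TangentAut E M) (x : M) (v : TangentSpace 𝓘(ℝ, E) x) :
    A x (A⁻¹ x v) = v := (A x).apply_symm_apply v

end TangentAut

end TangentAut

section Ad

variable {EG : Type*} [NormedAddCommGroup EG] [NormedSpace ℝ EG]
  {G : Type*} [TopologicalSpace G] [ChartedSpace EG G] [Group G]

/-- The adjoint action `Ad_g : T_e G → T_e G`, the derivative at `e` of `h ↦ g h g⁻¹`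
(which maps `e` to `e`). -/
def Ad (g : G) : GroupLieAlgebra 𝓘(ℝ, EG) G →L[ℝ] GroupLieAlgebra 𝓘(ℝ, EG) G :=
  (mfderiv 𝓘(ℝ, EG) 𝓘(ℝ, EG) (fun h : G => g * h * g⁻¹) 1 : EG →L[ℝ] EG)

end Ad

/-- A smooth principal `G`-bundle `P` over `M`: a smooth projection `proj`, a smooth right action
`act p g = pg` of `G` on `P` along the fibres of `proj`, and around each point of `M` a smooth
local trivialization `proj ⁻¹ U ≃ U × G` which is equivariant. -/
structure SmoothPrincipalBundle
    (EG : Type*) [NormedAddCommGroup EG] [NormedSpace ℝ EG]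
    (G : Type*) [TopologicalSpace G] [ChartedSpace EG G] [Group G]
    (EP : Type*) [NormedAddCommGroup EP] [NormedSpace ℝ EP]
    (P : Type*) [TopologicalSpace P] [ChartedSpace EP P]
    (EM : Type*) [NormedAddCommGroup EM] [NormedSpace ℝ EM]
    (M : Type*) [TopologicalSpace M] [ChartedSpace EM M] where
  proj : P → M
  act : P → G → P
  act_one : ∀ p, act p 1 = p
  act_mul : ∀ p g h, act p (g * h) = act (act p g) h
  proj_act : ∀ p g, proj (act p g) = proj p
  contMDiff_proj : ContMDiff 𝓘(ℝ, EP) 𝓘(ℝ, EM) ∞ proj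
  contMDiff_act : ContMDiff (𝓘(ℝ, EP).prod 𝓘(ℝ, EG)) 𝓘(ℝ, EP) ∞ (fun x : P × G => act x.1 x.2)
  exists_trivialization : ∀ m : M, ∃ e : Bundle.Trivialization G proj, m ∈ e.baseSet ∧
    ContMDiffOn 𝓘(ℝ, EP) (𝓘(ℝ, EM).prod 𝓘(ℝ, EG)) ∞ e e.source ∧
    ContMDiffOn (𝓘(ℝ, EM).prod 𝓘(ℝ, EG)) 𝓘(ℝ, EP) ∞ e.toOpenPartialHomeomorph.symm e.target ∧
    ∀ p ∈ e.source, ∀ g : G, e (act p g) = ((e p).1, (e p).2 * g)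

namespace SmoothPrincipalBundle

variable {EG : Type*} [NormedAddCommGroup EG] [NormedSpace ℝ EG]
  {G : Type*} [TopologicalSpace G] [ChartedSpace EG G] [Group G]
  {EP : Type*} [NormedAddCommGroup EP] [NormedSpace ℝ EP]
  {P : Type*} [TopologicalSpace P] [ChartedSpace EP P]
  {EM : Type*} [NormedAddCommGroup EM] [NormedSpace ℝ EM]
  {M : Type*} [TopologicalSpace M] [ChartedSpace EM M]
  (B : SmoothPrincipalBundle EG G EP P EM M)

/-- `Tκ_p(e) : T_e G → T_p P`, the derivative at `e` of `g ↦ pg`. -/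
def tOrbit (p : P) : GroupLieAlgebra 𝓘(ℝ, EG) G →L[ℝ] TangentSpace 𝓘(ℝ, EP) p :=
  (mfderiv 𝓘(ℝ, EG) 𝓘(ℝ, EP) (B.act p) 1 : EG →L[ℝ] EP)

/-- `Tκ_g(p) : T_p P → T_{pg} P`, the derivative at `p` of `q ↦ qg`. -/
def tAct (g : G) (p : P) : TangentSpace 𝓘(ℝ, EP) p →L[ℝ] TangentSpace 𝓘(ℝ, EP) (B.act p g) :=
  mfderiv 𝓘(ℝ, EP) 𝓘(ℝ, EP) (fun q => B.act q g) p

/-- `Tμ(p) : T_p P → T_{μ(p)} M`, the derivative at `p` of the bundle projection `μ`. -/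
def tProj (p : P) : TangentSpace 𝓘(ℝ, EP) p →L[ℝ] TangentSpace 𝓘(ℝ, EM) (B.proj p) :=
  mfderiv 𝓘(ℝ, EP) 𝓘(ℝ, EM) B.proj p

/-- The action `Φ_{(g,X)}(v) = Tκ_g(p)(v + Tκ_p(e) X)` on `TP` of the tangent group `TG`, whose
elements are the pairs `(g, X)` in `G × T_e G`. -/
def tangentGroupAct (g : G) (X : GroupLieAlgebra 𝓘(ℝ, EG) G) (p : P)
    (v : TangentSpace 𝓘(ℝ, EP) p) : TangentSpace 𝓘(ℝ, EP) (B.act p g) :=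
  B.tAct g p (v + B.tOrbit p X)

section Groups

variable [IsManifold 𝓘(ℝ, EP) ∞ P]

/-- `Aut_{TG} TP`: the automorphisms of `TP` covering the identity of `P` that commute with the
action of the tangent group `TG`. -/
def autTG : Subgroup (TangentAut EP P) where
  carrier := {A | ∀ (g : G) (X : GroupLieAlgebra 𝓘(ℝ, EG) G) (p : P)
    (v : TangentSpace 𝓘(ℝ, EP) p),
    A (B.act p g) (B.tangentGroupAct g X p v) = B.tangentGroupAct g X p (A p v)}
  mul_mem' {A C} hA hC g X p v := by
    rw [TangentAut.mul_apply, hC, hA, TangentAut.mul_apply]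
  one_mem' _ _ _ _ := rfl
  inv_mem' {A} hA g X p v := by
    have h := hA g X p (A⁻¹ p v)
    rw [TangentAut.apply_inv_apply] at h
    rw [← h, TangentAut.inv_apply, LinearEquiv.symm_apply_apply]

/-- `Aut_N TP`: the elements of `Aut_{TG} TP` of the form `A(p) = id + B(p)` where `B(p)` takes
values in the vertical space `Ker Tμ(p)`. -/
def autN : Subgroup B.autTG where
  carrier := {A | ∀ (p : P) (v : TangentSpace 𝓘(ℝ, EP) p),
    (A : TangentAut EP P) p v - v ∈ LinearMap.ker (B.tProj p).toLinearMap}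
  mul_mem' {A C} hA hC p v := by
    have := add_mem (hA p ((C : TangentAut EP P) p v)) (hC p v)
    rwa [sub_add_sub_cancel] at this
  one_mem' p v := by
    change v - v ∈ _
    rw [sub_self]
    exact zero_mem _
  inv_mem' {A} hA p v := by
    have := neg_mem (hA p ((A : TangentAut EP P)⁻¹ p v))
    rwa [TangentAut.apply_inv_apply, neg_sub] at this

end Groups

/-- A connection on the principal bundle: a smooth `T_e G`-valued one-form `α` on `P` such that
`α_p ∘ Tκ_p(e) = id` and `α_{pg} ∘ Tκ_g(p) = Ad_{g⁻¹} ∘ α_p`. -/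
@[ext]
structure Conn [IsManifold 𝓘(ℝ, EP) ∞ P] where
  form : ∀ p : P, TangentSpace 𝓘(ℝ, EP) p →ₗ[ℝ] GroupLieAlgebra 𝓘(ℝ, EG) G
  contMDiff_form : ContMDiff (M' := EG) 𝓘(ℝ, EP).tangent 𝓘(ℝ, EG) ∞
    (fun v : TangentBundle 𝓘(ℝ, EP) P => form v.1 v.2)
  form_tOrbit : ∀ (p : P) (X : GroupLieAlgebra 𝓘(ℝ, EG) G), form p (B.tOrbit p X) = X
  form_tAct : ∀ (p : P) (g : G) (v : TangentSpace 𝓘(ℝ, EP) p),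
    form (B.act p g) (B.tAct g p v) = Ad g⁻¹ (form p v)

section Calculus

variable {E₁ : Type*} [NormedAddCommGroup E₁] [NormedSpace ℝ E₁]
  {M₁ : Type*} [TopologicalSpace M₁] [ChartedSpace E₁ M₁]
  {E₂ : Type*} [NormedAddCommGroup E₂] [NormedSpace ℝ E₂]
  {M₂ : Type*} [TopologicalSpace M₂] [ChartedSpace E₂ M₂]
  {E₃ : Type*} [NormedAddCommGroup E₃] [NormedSpace ℝ E₃]
  {M₃ : Type*} [TopologicalSpace M₃] [ChartedSpace E₃ M₃]

theorem mfderiv_congr_all {f f' : M₁ → M₂} {x x' : M₁} (hf : f = f') (hx : x = x') :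
    (mfderiv 𝓘(ℝ, E₁) 𝓘(ℝ, E₂) f x : E₁ →L[ℝ] E₂) = mfderiv 𝓘(ℝ, E₁) 𝓘(ℝ, E₂) f' x' := by
  subst hf hx; rfl

theorem mfderiv_comp_all {f : M₁ → M₂} {g : M₂ → M₃} {h : M₁ → M₃} {x : M₁} {y : M₂}
    (hg : MDifferentiableAt 𝓘(ℝ, E₂) 𝓘(ℝ, E₃) g y) (hf : MDifferentiableAt 𝓘(ℝ, E₁) 𝓘(ℝ, E₂) f x)
    (hy : f x = y) (hh : h =ᶠ[nhds x] g ∘ f) (v : E₁) :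
    ((mfderiv 𝓘(ℝ, E₁) 𝓘(ℝ, E₃) h x : E₁ →L[ℝ] E₃) v : E₃) =
      (mfderiv 𝓘(ℝ, E₂) 𝓘(ℝ, E₃) g y : E₂ →L[ℝ] E₃)
        ((mfderiv 𝓘(ℝ, E₁) 𝓘(ℝ, E₂) f x : E₁ →L[ℝ] E₂) v) := by
  subst hy
  have h1 : (mfderiv 𝓘(ℝ, E₁) 𝓘(ℝ, E₃) h x : E₁ →L[ℝ] E₃) =
      mfderiv 𝓘(ℝ, E₁) 𝓘(ℝ, E₃) (g ∘ f) x := hh.mfderiv_eq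
  rw [h1]
  exact congrArg (fun L : E₁ →L[ℝ] E₃ => L v) (mfderiv_comp x hg hf)

end Calculus

section Lemmas

theorem mdifferentiableAt_act_right (g : G) (p : P) :
    MDifferentiableAt 𝓘(ℝ, EP) 𝓘(ℝ, EP) (fun q => B.act q g) p :=
  ((B.contMDiff_act.comp (contMDiff_id.prodMk contMDiff_const)).mdifferentiable
    (by simp)).mdifferentiableAt

theorem mdifferentiableAt_act (p : P) (g : G) :
    MDifferentiableAt 𝓘(ℝ, EG) 𝓘(ℝ, EP) (B.act p) g :=
  ((B.contMDiff_act.comp (contMDiff_const.prodMk contMDiff_id)).mdifferentiable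
    (by simp)).mdifferentiableAt

theorem mdifferentiableAt_proj (p : P) : MDifferentiableAt 𝓘(ℝ, EP) 𝓘(ℝ, EM) B.proj p :=
  (B.contMDiff_proj.mdifferentiable (by simp)).mdifferentiableAt

theorem tProj_tAct (g : G) (p : P) (v : TangentSpace 𝓘(ℝ, EP) p) :
    (B.tProj (B.act p g) (B.tAct g p v) : EM) = B.tProj p v := by
  refine (mfderiv_comp_all (h := B.proj) (B.mdifferentiableAt_proj _)
    (B.mdifferentiableAt_act_right g p) rfl ?_ v).symm
  exact Filter.Eventually.of_forall fun q => (B.proj_act q g).symm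

theorem tProj_tOrbit (p : P) (X : GroupLieAlgebra 𝓘(ℝ, EG) G) : B.tProj p (B.tOrbit p X) = 0 := by
  have h := mfderiv_comp_all (h := fun _ : G => B.proj p) (B.mdifferentiableAt_proj p)
    (B.mdifferentiableAt_act p 1) (B.act_one p)
    (Filter.Eventually.of_forall fun g => (B.proj_act p g).symm) X
  refine h.symm.trans ?_
  rw [mfderiv_const]
  rfl

theorem tAct_one (p : P) (v : TangentSpace 𝓘(ℝ, EP) p) : (B.tAct 1 p v : EP) = v := by
  have h : (fun q => B.act q 1) = (id : P → P) := funext B.act_one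
  have := congrArg (fun L : EP →L[ℝ] EP => L v)
    ((mfderiv_congr_all h (rfl : p = p)).trans (mfderiv_id (I := 𝓘(ℝ, EP)) (x := p)))
  exact this

theorem tAct_tOrbit [LieGroup 𝓘(ℝ, EG) ∞ G] (g : G) (p : P) (X : GroupLieAlgebra 𝓘(ℝ, EG) G) :
    B.tAct g p (B.tOrbit p X) = B.tOrbit (B.act p g) (Ad g⁻¹ X) := by
  have hm : MDifferentiableAt 𝓘(ℝ, EG) 𝓘(ℝ, EG) (fun h : G => g⁻¹ * h * g⁻¹⁻¹) 1 :=
    ((((contMDiff_const (c := g⁻¹)).mul contMDiff_id).mul contMDiff_const).mdifferentiable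
      (n := ∞) (by simp)).mdifferentiableAt
  have h1 := mfderiv_comp_all (h := fun h => B.act p (h * g)) (B.mdifferentiableAt_act_right g p)
    (B.mdifferentiableAt_act p 1) (B.act_one p)
    (Filter.Eventually.of_forall fun h => B.act_mul p h g) X
  have h2 := mfderiv_comp_all (h := fun h => B.act p (h * g)) (B.mdifferentiableAt_act (B.act p g) 1)
    hm (by simp)
    (Filter.Eventually.of_forall fun h => by
      simp only [Function.comp_apply, ← B.act_mul]; congr 1; group) X
  exact h1.symm.trans h2

variable [IsManifold 𝓘(ℝ, EP) ∞ P]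

theorem tangentAut_congr (A : TangentAut EP P) {p q : P} (h : p = q) {v w : EP} (hv : v = w) :
    (A p v : EP) = A q w := by
  subst h hv; rfl

theorem autTG_tAct {A : TangentAut EP P} (hA : A ∈ B.autTG) (g : G) (p : P)
    (v : TangentSpace 𝓘(ℝ, EP) p) : A (B.act p g) (B.tAct g p v) = B.tAct g p (A p v) := by
  have := hA g 0 p v
  simpa [tangentGroupAct] using this

theorem autTG_tOrbit {A : TangentAut EP P} (hA : A ∈ B.autTG) (p : P)
    (X : GroupLieAlgebra 𝓘(ℝ, EG) G) : A p (B.tOrbit p X) = B.tOrbit p X := by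
  have h := hA 1 X p 0
  simp only [tangentGroupAct, map_zero, zero_add] at h
  have h2 := tangentAut_congr A (B.act_one p) (B.tAct_one p (B.tOrbit p X))
  exact h2.symm.trans (Eq.trans h (B.tAct_one p _))

theorem mem_autTG_of {A : TangentAut EP P}
    (h1 : ∀ (p : P) (X : GroupLieAlgebra 𝓘(ℝ, EG) G), A p (B.tOrbit p X) = B.tOrbit p X)
    (h2 : ∀ (g : G) (p : P) (v : TangentSpace 𝓘(ℝ, EP) p),
      A (B.act p g) (B.tAct g p v) = B.tAct g p (A p v)) : A ∈ B.autTG := by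
  intro g X p v
  rw [tangentGroupAct, tangentGroupAct, h2, map_add, h1]

variable {B} in
theorem Conn.ext_apply {α β : B.Conn} (h : ∀ (p : P) (v : TangentSpace 𝓘(ℝ, EP) p),
    α.form p v = β.form p v) : α = β :=
  Conn.ext (funext fun p => LinearMap.ext (h p))

/-- The left action `φ_A(α)_p = α_p ∘ A(p)⁻¹` of `Aut_{TG} TP` on connections. -/
instance : MulAction B.autTG B.Conn where
  smul A α :=
    { form := fun p => α.form p ∘ₗ ((A : TangentAut EP P) p).symm.toLinearMap
      contMDiff_form := α.contMDiff_form.comp (A : TangentAut EP P).contMDiff_invFun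
      form_tOrbit := fun p X => by
        have h := B.autTG_tOrbit (B.autTG.inv_mem A.2) p X
        exact (congrArg (α.form p) h).trans (α.form_tOrbit p X)
      form_tAct := fun p g v => by
        have h := B.autTG_tAct (B.autTG.inv_mem A.2) g p v
        exact (congrArg (α.form (B.act p g)) h).trans (α.form_tAct p g _) }
  one_smul _ := rfl
  mul_smul _ _ _ := rfl

theorem smul_form (A : B.autTG) (α : B.Conn) (p : P) (v : TangentSpace 𝓘(ℝ, EP) p) :
    (A • α).form p v = α.form p (((A : TangentAut EP P) p).symm v) := rfl

end Lemmas

section Lift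

theorem exists_section (m : M) : ∃ (U : Set M) (s : M → P) (γ : P → G), IsOpen U ∧ m ∈ U ∧
    ContMDiffOn 𝓘(ℝ, EM) 𝓘(ℝ, EP) ∞ s U ∧
    ContMDiffOn 𝓘(ℝ, EP) 𝓘(ℝ, EG) ∞ γ (B.proj ⁻¹' U) ∧
    (∀ x ∈ U, B.proj (s x) = x) ∧ (∀ p, B.proj p ∈ U → B.act (s (B.proj p)) (γ p) = p) := by
  obtain ⟨e, hm, he, he', hact⟩ := B.exists_trivialization m
  refine ⟨e.baseSet, fun x => e.toOpenPartialHomeomorph.symm (x, 1), fun p => (e p).2,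
    e.open_baseSet, hm, ?_, ?_, ?_, ?_⟩
  · refine he'.comp (contMDiff_id.prodMk contMDiff_const).contMDiffOn fun x hx => ?_
    exact e.mem_target.2 hx
  · rw [← e.source_eq]
    exact contMDiff_snd.comp_contMDiffOn he
  · intro x hx
    exact e.proj_symm_apply (e.mem_target.2 hx)
  · intro p hp
    have ht : (B.proj p, (1 : G)) ∈ e.target := e.mem_target.2 hp
    have hs : e.toOpenPartialHomeomorph.symm (B.proj p, 1) ∈ e.source :=
      e.toOpenPartialHomeomorph.map_target ht
    have hp' : p ∈ e.source := e.mem_source.2 hp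
    have h1 := hact _ hs (e p).2
    have h2 : e (e.toOpenPartialHomeomorph.symm (B.proj p, 1)) = (B.proj p, 1) :=
      e.apply_symm_apply ht
    rw [h2, one_mul, e.mk_proj_snd hp'] at h1
    refine e.injOn ?_ hp' h1
    rw [e.mem_source, B.proj_act]
    exact e.mem_source.1 hs

theorem proj_surjective : Function.Surjective B.proj := fun m => by
  obtain ⟨U, s, γ, -, hm, -, -, h, -⟩ := B.exists_section m
  exact ⟨s m, h m hm⟩

theorem exists_act_eq {p q : P} (h : B.proj p = B.proj q) : ∃ g, q = B.act p g := by
  obtain ⟨U, s, γ, -, hm, -, -, -, h'⟩ := B.exists_section (B.proj q)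
  refine ⟨(γ p)⁻¹ * γ q, ?_⟩
  have h1 := h' p (h ▸ hm)
  have h2 := h' q hm
  rw [h] at h1
  calc q = B.act (s (B.proj q)) (γ p * ((γ p)⁻¹ * γ q)) := by rw [mul_inv_cancel_left, h2]
    _ = _ := by rw [B.act_mul, h1]

theorem tProj_surjective (p : P) : Function.Surjective (B.tProj p) := fun w => by
  obtain ⟨U, s, γ, hU, hm, hs, -, h, h'⟩ := B.exists_section (B.proj p)
  have hsm : MDifferentiableAt 𝓘(ℝ, EM) 𝓘(ℝ, EP) s (B.proj p) :=
    (hs.contMDiffAt (hU.mem_nhds hm)).mdifferentiableAt (by simp)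
  have hs2 := (B.mdifferentiableAt_act_right (γ p) (s (B.proj p))).comp (B.proj p) hsm
  have := mfderiv_comp_all (h := fun x : M => x) (B.mdifferentiableAt_proj p) hs2 (h' p hm)
    (Filter.eventually_of_mem (hU.mem_nhds hm) fun x hx => by
      simp [B.proj_act, h x hx]) w
  refine ⟨_, this.symm.trans ?_⟩
  exact congrArg (fun L : EM →L[ℝ] EM => L w) (mfderiv_id (I := 𝓘(ℝ, EM)) (x := B.proj p))

theorem exists_tOrbit_of_tProj_eq_zero [LieGroup 𝓘(ℝ, EG) ∞ G] (p : P)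
    (v : TangentSpace 𝓘(ℝ, EP) p) (hv : B.tProj p v = 0) : ∃ X, v = B.tOrbit p X := by
  obtain ⟨U, s, γ, hU, hm, hs, hγ, h, h'⟩ := B.exists_section (B.proj p)
  have hsm : MDifferentiableAt 𝓘(ℝ, EM) 𝓘(ℝ, EP) s (B.proj p) :=
    (hs.contMDiffAt (hU.mem_nhds hm)).mdifferentiableAt (by simp)
  have hUp : B.proj ⁻¹' U ∈ nhds p := (hU.preimage B.contMDiff_proj.continuous).mem_nhds hm
  have hγm : MDifferentiableAt 𝓘(ℝ, EP) 𝓘(ℝ, EG) γ p :=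
    (hγ.contMDiffAt hUp).mdifferentiableAt (by simp)
  have hsp := hsm.comp p (B.mdifferentiableAt_proj p)
  have ha : MDifferentiableAt (𝓘(ℝ, EP).prod 𝓘(ℝ, EG)) 𝓘(ℝ, EP)
      (fun x : P × G => B.act x.1 x.2) (s (B.proj p), γ p) :=
    (B.contMDiff_act.mdifferentiable (by simp)).mdifferentiableAt
  have hid : (mfderiv 𝓘(ℝ, EP) 𝓘(ℝ, EP) (fun q : P => q) p : EP →L[ℝ] EP) =
      mfderiv 𝓘(ℝ, EP) 𝓘(ℝ, EP)
        ((fun x : P × G => B.act x.1 x.2) ∘ fun q => (s (B.proj q), γ q)) p :=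
    Filter.EventuallyEq.mfderiv_eq (Filter.eventually_of_mem hUp fun q hq => (h' q hq).symm)
  have hid' := (mfderiv_id (I := 𝓘(ℝ, EP)) (x := p)).symm.trans hid
  have h0 : (mfderiv 𝓘(ℝ, EP) 𝓘(ℝ, EP) (s ∘ B.proj) p : EP →L[ℝ] EP) v = (0 : EP) := by
    refine (mfderiv_comp_all hsm (B.mdifferentiableAt_proj p) rfl (Filter.EventuallyEq.refl _ _)
      v).trans ?_
    exact (congrArg (mfderiv 𝓘(ℝ, EM) 𝓘(ℝ, EP) s (B.proj p) : EM →L[ℝ] EP) hv).trans (map_zero _)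
  have h1 : (v : EP) = (mfderiv 𝓘(ℝ, EG) 𝓘(ℝ, EP) (B.act (s (B.proj p))) (γ p) : EG →L[ℝ] EP)
      ((mfderiv 𝓘(ℝ, EP) 𝓘(ℝ, EG) γ p : EP →L[ℝ] EG) v) := by
    refine (congrArg (fun L : EP →L[ℝ] EP => L v) hid').trans ?_
    refine (congrArg (fun L : EP →L[ℝ] EP => L v)
      (mfderiv_comp p (f := fun q => (s (B.proj q), γ q)) ha (hsp.prodMk hγm))).trans ?_
    have h2 := mfderiv_prodMk hsp hγm
    refine (congrArg (fun L : EP →L[ℝ] EP × EG => (mfderiv (𝓘(ℝ, EP).prod 𝓘(ℝ, EG)) 𝓘(ℝ, EP)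
      (fun x : P × G => B.act x.1 x.2) (s (B.proj p), γ p) : EP × EG →L[ℝ] EP) (L v)) h2).trans ?_
    refine (mfderiv_prod_eq_add_apply (I := 𝓘(ℝ, EP)) (I' := 𝓘(ℝ, EG)) ha).trans ?_
    refine (congrArg₂ (fun x y : EP => x + y) (?_ : _ = (0 : EP)) rfl).trans (zero_add _)
    exact (congrArg (mfderiv 𝓘(ℝ, EP) 𝓘(ℝ, EP) (fun q => B.act q (γ p)) (s (B.proj p)) :
      EP →L[ℝ] EP) h0).trans (map_zero _)
  have hm : MDifferentiableAt 𝓘(ℝ, EG) 𝓘(ℝ, EG) (fun k : G => (γ p)⁻¹ * k) (γ p) :=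
    (((contMDiff_const (c := (γ p)⁻¹)).mul contMDiff_id).mdifferentiable
      (n := ∞) (by simp)).mdifferentiableAt
  refine ⟨_, h1.trans (mfderiv_comp_all (B.mdifferentiableAt_act p 1) hm (by simp)
    (Filter.Eventually.of_forall fun k => ?_) _)⟩
  conv_rhs => rw [Function.comp_apply, ← h' p ‹_›, ← B.act_mul]
  rw [h' p ‹_›, mul_inv_cancel_left]

end Lift

section HorizontalLift

variable [IsManifold 𝓘(ℝ, EP) ∞ P] {B} (α : B.Conn)

/-- The horizontal space `Ker α_p`. -/
def Conn.horSpace (p : P) : Submodule ℝ (TangentSpace 𝓘(ℝ, EP) p) := LinearMap.ker (α.form p)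

theorem Conn.sub_mem_horSpace (p : P) (v : TangentSpace 𝓘(ℝ, EP) p) :
    v - B.tOrbit p (α.form p v) ∈ α.horSpace p := by
  change α.form p _ = 0
  rw [map_sub, α.form_tOrbit, sub_self]

variable [LieGroup 𝓘(ℝ, EG) ∞ G]

theorem Conn.tProj_bijective (p : P) :
    Function.Bijective ((B.tProj p).toLinearMap.domRestrict (α.horSpace p)) := by
  constructor
  · rw [← LinearMap.ker_eq_bot, LinearMap.ker_eq_bot']
    intro v hv
    obtain ⟨X, hX⟩ := B.exists_tOrbit_of_tProj_eq_zero p v hv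
    have h0 : α.form p v = 0 := v.2
    rw [hX, α.form_tOrbit] at h0
    rw [h0, map_zero] at hX
    exact Subtype.ext hX
  · intro w
    obtain ⟨v, hv⟩ := B.tProj_surjective p w
    refine ⟨⟨_, α.sub_mem_horSpace p v⟩, ?_⟩
    change B.tProj p (v - B.tOrbit p (α.form p v)) = w
    rw [map_sub, B.tProj_tOrbit, hv, sub_zero]

/-- The isomorphism `Γ_α(p) : T_{μ(p)} M → Ker α_p`, the inverse of the restriction of `Tμ(p)` to
the horizontal space. -/
def Conn.horLiftEquiv (p : P) : TangentSpace 𝓘(ℝ, EM) (B.proj p) ≃ₗ[ℝ] α.horSpace p :=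
  (LinearEquiv.ofBijective _ (α.tProj_bijective p)).symm

/-- The horizontal lift `Γ_α(p)` as a linear map `T_{μ(p)} M → T_p P`. -/
def Conn.horLift (p : P) : TangentSpace 𝓘(ℝ, EM) (B.proj p) →ₗ[ℝ] TangentSpace 𝓘(ℝ, EP) p :=
  (α.horSpace p).subtype ∘ₗ (α.horLiftEquiv p).toLinearMap

theorem Conn.form_horLift (p : P) (w : TangentSpace 𝓘(ℝ, EM) (B.proj p)) :
    α.form p (α.horLift p w) = 0 := (α.horLiftEquiv p w).2

theorem Conn.tProj_horLift (p : P) (w : TangentSpace 𝓘(ℝ, EM) (B.proj p)) :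
    B.tProj p (α.horLift p w) = w :=
  (LinearEquiv.ofBijective _ (α.tProj_bijective p)).apply_symm_apply w

theorem Conn.eq_horLift (p : P) (v : TangentSpace 𝓘(ℝ, EP) p) :
    v = B.tOrbit p (α.form p v) + α.horLift p (B.tProj p v) := by
  have h : α.horLiftEquiv p (B.tProj p v) = ⟨_, α.sub_mem_horSpace p v⟩ := by
    refine ((LinearEquiv.ofBijective _ (α.tProj_bijective p)).symm_apply_eq).2 ?_
    change _ = B.tProj p (v - B.tOrbit p (α.form p v))
    rw [map_sub, B.tProj_tOrbit, sub_zero]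
  have h2 : α.horLift p (B.tProj p v) = v - B.tOrbit p (α.form p v) := congrArg Subtype.val h
  rw [h2, add_sub_cancel]

/-- A vector is determined by its vertical component and its projection. -/
theorem Conn.ext_vector (p : P) {v w : TangentSpace 𝓘(ℝ, EP) p} (h1 : α.form p v = α.form p w)
    (h2 : B.tProj p v = B.tProj p w) : v = w := by
  rw [α.eq_horLift p v, α.eq_horLift p w, h1, h2]

theorem Conn.horLift_act (g : G) (p : P) (w : TangentSpace 𝓘(ℝ, EM) (B.proj (B.act p g)))
    (w' : TangentSpace 𝓘(ℝ, EM) (B.proj p)) (hw : (w : EM) = w') :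
    α.horLift (B.act p g) w = B.tAct g p (α.horLift p w') := by
  refine α.ext_vector _ ?_ ?_
  · rw [α.form_horLift, α.form_tAct, α.form_horLift, map_zero]
  · refine (α.tProj_horLift _ _).trans ?_
    exact hw.trans (Eq.trans (B.tProj_tAct g p _) (α.tProj_horLift p w')).symm

end HorizontalLift

section Lambda

variable [IsManifold 𝓘(ℝ, EP) ∞ P] [LieGroup 𝓘(ℝ, EG) ∞ G]

theorem tProj_apply_eq {A : TangentAut EP P} (hA : A ∈ B.autTG) {p q : P}
    (h : B.proj p = B.proj q) (v : TangentSpace 𝓘(ℝ, EP) p) (w : TangentSpace 𝓘(ℝ, EP) q)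
    (hvw : (B.tProj p v : EM) = B.tProj q w) :
    (B.tProj p (A p v) : EM) = B.tProj q (A q w) := by
  obtain ⟨g, rfl⟩ := B.exists_act_eq h
  have h1 : B.tProj (B.act p g) (w - B.tAct g p v) = 0 := by
    rw [map_sub]
    exact sub_eq_zero.2 (hvw.symm.trans (B.tProj_tAct g p v).symm)
  obtain ⟨X, hX⟩ := B.exists_tOrbit_of_tProj_eq_zero _ _ h1
  rw [sub_eq_iff_eq_add] at hX
  rw [hX, map_add, B.autTG_tOrbit hA, B.autTG_tAct hA, map_add, B.tProj_tOrbit, zero_add]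
  exact (B.tProj_tAct g p _).symm

theorem exists_lambdaMap {A : TangentAut EP P} (hA : A ∈ B.autTG) (m : M) :
    ∃ L : TangentSpace 𝓘(ℝ, EM) m →ₗ[ℝ] TangentSpace 𝓘(ℝ, EM) m,
      ∀ (p : P), B.proj p = m → ∀ v : TangentSpace 𝓘(ℝ, EP) p,
        (L (B.tProj p v : EM) : EM) = B.tProj p (A p v) := by
  obtain ⟨q, rfl⟩ := B.proj_surjective m
  obtain ⟨R, hR⟩ := LinearMap.exists_rightInverse_of_surjective (B.tProj q).toLinearMap
    (LinearMap.range_eq_top.2 (B.tProj_surjective q))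
  refine ⟨(B.tProj q).toLinearMap ∘ₗ (A q).toLinearMap ∘ₗ R, fun p hp v => ?_⟩
  refine B.tProj_apply_eq hA hp.symm _ _ ?_
  exact congrArg (fun L : EM →ₗ[ℝ] EM => L (B.tProj p v : EM)) hR

/-- The endomorphism of `T_m M` induced by `A ∈ Aut_{TG} TP`: it maps `Tμ(p) v` to `Tμ(p)(A(p) v)`
for all `p` over `m` and `v ∈ T_p P`. -/
def lambdaMap (A : B.autTG) (m : M) : TangentSpace 𝓘(ℝ, EM) m →ₗ[ℝ] TangentSpace 𝓘(ℝ, EM) m :=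
  (B.exists_lambdaMap A.2 m).choose

theorem lambdaMap_tProj (A : B.autTG) (p : P) (v : TangentSpace 𝓘(ℝ, EP) p) :
    B.lambdaMap A (B.proj p) (B.tProj p v) = B.tProj p ((A : TangentAut EP P) p v) :=
  (B.exists_lambdaMap A.2 (B.proj p)).choose_spec p rfl v

theorem lambdaMap_mul (A C : B.autTG) (m : M) (w : TangentSpace 𝓘(ℝ, EM) m) :
    B.lambdaMap (A * C) m w = B.lambdaMap A m (B.lambdaMap C m w) := by
  obtain ⟨p, rfl⟩ := B.proj_surjective m
  obtain ⟨v, rfl⟩ := B.tProj_surjective p w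
  simp only [lambdaMap_tProj]
  rfl

theorem lambdaMap_one (m : M) (w : TangentSpace 𝓘(ℝ, EM) m) :
    B.lambdaMap 1 m w = w := by
  obtain ⟨p, rfl⟩ := B.proj_surjective m
  obtain ⟨v, rfl⟩ := B.tProj_surjective p w
  simp only [lambdaMap_tProj]
  rfl

variable [IsManifold 𝓘(ℝ, EM) ∞ M]

theorem contMDiff_lambdaMap (A : B.autTG) : ContMDiff 𝓘(ℝ, EM).tangent 𝓘(ℝ, EM).tangent ∞
    (fun v : TangentBundle 𝓘(ℝ, EM) M =>
      (⟨v.1, B.lambdaMap A v.1 v.2⟩ : TangentBundle 𝓘(ℝ, EM) M)) := by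
  intro v
  obtain ⟨U, s, γ, hU, hm, hs, -, h, -⟩ := B.exists_section v.1
  have hs' := hs.contMDiffOn_tangentMapWithin (m := ∞) (by simp) hU.uniqueMDiffOn
  have hV : IsOpen (Bundle.TotalSpace.proj ⁻¹' U : Set (TangentBundle 𝓘(ℝ, EM) M)) :=
    hU.preimage (FiberBundle.continuous_proj EM (TangentSpace 𝓘(ℝ, EM)))
  have hproj := B.contMDiff_proj.contMDiff_tangentMap (m := ∞) (by simp)
  have hc := (hproj.comp (A : TangentAut EP P).contMDiff_toFun).comp_contMDiffOn hs'
  refine (hc.congr ?_).contMDiffAt (hV.mem_nhds hm)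
  rintro ⟨x, w⟩ (hx : x ∈ U)
  have hsm : MDifferentiableAt 𝓘(ℝ, EM) 𝓘(ℝ, EP) s x :=
    (hs.contMDiffAt (hU.mem_nhds hx)).mdifferentiableAt (by simp)
  have h1 := mfderiv_comp_all (h := fun x : M => x) (B.mdifferentiableAt_proj (s x)) hsm rfl
    (Filter.eventually_of_mem (hU.mem_nhds hx) fun y hy => (h y hy).symm) w
  have h2 : (B.tProj (s x) (mfderiv 𝓘(ℝ, EM) 𝓘(ℝ, EP) s x w) : EM) = w :=
    h1.symm.trans (congrArg (fun L : EM →L[ℝ] EM => L w) (mfderiv_id (I := 𝓘(ℝ, EM)) (x := x)))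
  have h3 := (B.exists_lambdaMap A.2 x).choose_spec (s x) (h x hx)
    (mfderiv 𝓘(ℝ, EM) 𝓘(ℝ, EP) s x w)
  have h4 : (B.lambdaMap A x w : EM) = B.tProj (s x) ((A : TangentAut EP P) (s x)
      (mfderiv 𝓘(ℝ, EM) 𝓘(ℝ, EP) s x w)) := by
    refine Eq.trans ?_ h3
    exact congrArg (fun u : EM => (B.lambdaMap A x u : EM)) h2.symm
  have h5 : (mfderivWithin 𝓘(ℝ, EM) 𝓘(ℝ, EP) s U x : EM →L[ℝ] EP) = mfderiv 𝓘(ℝ, EM) 𝓘(ℝ, EP) s x :=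
    mfderivWithin_of_isOpen hU hx
  simp only [Function.comp_apply, tangentMapWithin, tangentMap]
  have key : ∀ (y : M) (a : EM) (b : EM), x = y → a = b →
      (⟨x, a⟩ : TangentBundle 𝓘(ℝ, EM) M) = ⟨y, b⟩ := by
    rintro y a b rfl rfl; rfl
  refine key _ _ _ (h x hx).symm (h4.trans ?_)
  exact congrArg (fun L : EM →L[ℝ] EP =>
    (B.tProj (s x) ((A : TangentAut EP P) (s x) (L w)) : EM)) h5.symm

/-- The group morphism `λ : Aut_{TG} TP → Aut_0 TM`, determined by
`λ(A)(μ(p)) (Tμ(p) v) = Tμ(p)(A(p) v)`. -/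
def lambda : B.autTG →* TangentAut EM M where
  toFun A :=
    { toFun := fun m => LinearEquiv.ofLinearMap (B.lambdaMap A m) (B.lambdaMap A⁻¹ m)
        (LinearMap.ext fun w => by
          change B.lambdaMap A m (B.lambdaMap A⁻¹ m w) = w
          rw [← lambdaMap_mul, mul_inv_cancel, lambdaMap_one])
        (LinearMap.ext fun w => by
          change B.lambdaMap A⁻¹ m (B.lambdaMap A m w) = w
          rw [← lambdaMap_mul, inv_mul_cancel, lambdaMap_one])
      contMDiff_toFun := B.contMDiff_lambdaMap A
      contMDiff_invFun := B.contMDiff_lambdaMap A⁻¹ }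
  map_one' := TangentAut.ext_apply fun m w => B.lambdaMap_one m w
  map_mul' A C := TangentAut.ext_apply fun m w => B.lambdaMap_mul A C m w

theorem lambda_tProj (A : B.autTG) (p : P) (v : TangentSpace 𝓘(ℝ, EP) p) :
    B.lambda A (B.proj p) (B.tProj p v) = B.tProj p ((A : TangentAut EP P) p v) :=
  B.lambdaMap_tProj A p v

end Lambda

section Sigma

variable [LieGroup 𝓘(ℝ, EG) ∞ G]

theorem contMDiff_fiber_one : ContMDiff 𝓘(ℝ, EG) 𝓘(ℝ, EG).tangent ∞
    (fun X : EG => (⟨1, X⟩ : TangentBundle 𝓘(ℝ, EG) G)) := by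
  intro X
  rw [Bundle.contMDiffAt_totalSpace]
  refine ⟨contMDiffAt_const, ?_⟩
  let L : EG →L[ℝ] EG := (trivializationAt EG (TangentSpace 𝓘(ℝ, EG)) (1 : G)).continuousLinearMapAt ℝ 1
  have hL : ContMDiff 𝓘(ℝ, EG) 𝓘(ℝ, EG) ∞ L := L.contMDiff
  refine (hL X).congr_of_eventuallyEq (Filter.Eventually.of_forall fun Y => ?_)
  have h1 : (1 : G) ∈ (trivializationAt EG (TangentSpace 𝓘(ℝ, EG)) (1 : G)).baseSet :=
    FiberBundle.mem_baseSet_trivializationAt' 1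
  exact (Bundle.Trivialization.continuousLinearMapAt_apply_of_mem ℝ _ h1 Y).symm

variable [IsManifold 𝓘(ℝ, EP) ∞ P]

/-- The tangent map of the action `P × G → P`. -/
theorem contMDiff_tangentAct :
    ContMDiff (𝓘(ℝ, EP).tangent.prod 𝓘(ℝ, EG).tangent) 𝓘(ℝ, EP).tangent ∞
      (fun x : TangentBundle 𝓘(ℝ, EP) P × TangentBundle 𝓘(ℝ, EG) G =>
        (⟨B.act x.1.1 x.2.1, B.tAct x.2.1 x.1.1 x.1.2 +
          mfderiv 𝓘(ℝ, EG) 𝓘(ℝ, EP) (B.act x.1.1) x.2.1 x.2.2⟩ : TangentBundle 𝓘(ℝ, EP) P)) := by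
  have h1 := (B.contMDiff_act.contMDiff_tangentMap (m := ∞) (by simp)).comp
    (contMDiff_equivTangentBundleProd_symm (I := 𝓘(ℝ, EP)) (M := P) (I' := 𝓘(ℝ, EG)) (M' := G))
  refine h1.congr fun x => ?_
  have ha : MDifferentiableAt (𝓘(ℝ, EP).prod 𝓘(ℝ, EG)) 𝓘(ℝ, EP)
      (fun x : P × G => B.act x.1 x.2) (x.1.1, x.2.1) :=
    (B.contMDiff_act.mdifferentiable (by simp)).mdifferentiableAt
  have h2 := mfderiv_prod_eq_add_apply (I := 𝓘(ℝ, EP)) (I' := 𝓘(ℝ, EG))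
    (v := (x.1.2, x.2.2)) ha
  exact congrArg (Bundle.TotalSpace.mk (F := EP) (E := TangentSpace 𝓘(ℝ, EP))
    (B.act x.1.1 x.2.1)) h2.symm

variable [IsManifold 𝓘(ℝ, EM) ∞ M]

variable {B} in
/-- The endomorphism `σ_α(Ã)(p) = Tκ_p(e) ∘ α_p + Γ_α(p) ∘ Ã(μ(p)) ∘ Tμ(p)` of `T_p P`; the first
summand is the projection onto the vertical space along the horizontal space. -/
def Conn.sigmaMap (α : B.Conn) (A : TangentAut EM M) (p : P) :
    TangentSpace 𝓘(ℝ, EP) p →ₗ[ℝ] TangentSpace 𝓘(ℝ, EP) p :=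
  (B.tOrbit p).toLinearMap ∘ₗ α.form p +
    α.horLift p ∘ₗ (A (B.proj p)).toLinearMap ∘ₗ (B.tProj p).toLinearMap

variable {B} (α : B.Conn)

theorem Conn.sigmaMap_apply (A : TangentAut EM M) (p : P) (v : TangentSpace 𝓘(ℝ, EP) p) :
    α.sigmaMap A p v = B.tOrbit p (α.form p v) + α.horLift p (A (B.proj p) (B.tProj p v)) := rfl

theorem Conn.form_sigmaMap (A : TangentAut EM M) (p : P) (v : TangentSpace 𝓘(ℝ, EP) p) :
    α.form p (α.sigmaMap A p v) = α.form p v := by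
  rw [sigmaMap_apply, map_add, α.form_tOrbit, α.form_horLift, add_zero]

theorem Conn.tProj_sigmaMap (A : TangentAut EM M) (p : P) (v : TangentSpace 𝓘(ℝ, EP) p) :
    B.tProj p (α.sigmaMap A p v) = A (B.proj p) (B.tProj p v) := by
  rw [sigmaMap_apply, map_add, B.tProj_tOrbit, α.tProj_horLift, zero_add]

theorem Conn.sigmaMap_mul (A C : TangentAut EM M) (p : P) (v : TangentSpace 𝓘(ℝ, EP) p) :
    α.sigmaMap (A * C) p v = α.sigmaMap A p (α.sigmaMap C p v) := by
  refine α.ext_vector _ ?_ ?_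
  · simp only [form_sigmaMap]
  · simp only [tProj_sigmaMap, TangentAut.mul_apply]

theorem Conn.sigmaMap_one (p : P) (v : TangentSpace 𝓘(ℝ, EP) p) : α.sigmaMap 1 p v = v := by
  refine α.ext_vector _ ?_ ?_
  · simp only [form_sigmaMap]
  · simp only [tProj_sigmaMap, TangentAut.one_apply]

theorem Conn.contMDiff_sigmaMap (A : TangentAut EM M) :
    ContMDiff 𝓘(ℝ, EP).tangent 𝓘(ℝ, EP).tangent ∞
      (fun v : TangentBundle 𝓘(ℝ, EP) P =>
        (⟨v.1, α.sigmaMap A v.1 v.2⟩ : TangentBundle 𝓘(ℝ, EP) P)) := by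
  intro v
  obtain ⟨U, s, γ, hU, hm, hs, hγ, h, h'⟩ := B.exists_section (B.proj v.1)
  have hs' := hs.contMDiffOn_tangentMapWithin (m := ∞) (by simp) hU.uniqueMDiffOn
  have hUp : IsOpen (B.proj ⁻¹' U) := hU.preimage B.contMDiff_proj.continuous
  set V : Set (TangentBundle 𝓘(ℝ, EP) P) := Bundle.TotalSpace.proj ⁻¹' (B.proj ⁻¹' U) with hVdef
  have hV : IsOpen V := hUp.preimage (FiberBundle.continuous_proj EP (TangentSpace 𝓘(ℝ, EP)))
  have hproj := B.contMDiff_proj.contMDiff_tangentMap (m := ∞) (by simp)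
  have hbase : ContMDiff 𝓘(ℝ, EP).tangent 𝓘(ℝ, EP) ∞
      (Bundle.TotalSpace.proj : TangentBundle 𝓘(ℝ, EP) P → P) :=
    Bundle.contMDiff_proj (TangentSpace 𝓘(ℝ, EP))
  have h1 := hs'.comp (s := V) (A.contMDiff_toFun.comp hproj).contMDiffOn fun x hx => hx
  have h2 := (Bundle.contMDiff_zeroSection ℝ (TangentSpace 𝓘(ℝ, EG) : G → Type _)
    (F := EG) (IB := 𝓘(ℝ, EG)) (n := ∞)).comp_contMDiffOn
    (hγ.comp (s := V) hbase.contMDiffOn fun x hx => hx)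
  -- a smooth, not necessarily horizontal, lift of `A (Tμ v)`
  have hu := B.contMDiff_tangentAct.comp_contMDiffOn (h1.prodMk h2)
  have h3 := α.contMDiff_form.comp_contMDiffOn hu
  have h4 := (contMDiff_fiber_one (G := G)).comp_contMDiffOn
    ((α.contMDiff_form.contMDiffOn (s := V)).sub h3)
  have h5 := B.contMDiff_tangentAct.comp_contMDiffOn (hu.prodMk h4)
  refine (h5.congr ?_).contMDiffAt (hV.mem_nhds hm)
  rintro ⟨p, w⟩ (hp : B.proj p ∈ U)
  have key : ∀ (q : P) (u : TangentSpace 𝓘(ℝ, EP) q), q = p →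
      (B.tProj q u : EM) = A (B.proj p) (B.tProj p w) →
      (⟨p, α.sigmaMap A p w⟩ : TangentBundle 𝓘(ℝ, EP) P) =
        ⟨B.act q 1, B.tAct 1 q u +
          mfderiv 𝓘(ℝ, EG) 𝓘(ℝ, EP) (B.act q) 1 (α.form p w - α.form q u : EG)⟩ := by
    rintro q u rfl hu
    have e1 : α.sigmaMap A q w = u + B.tOrbit q (α.form q w - α.form q u) := by
      refine α.ext_vector _ ?_ ?_
      · rw [α.form_sigmaMap, map_add, α.form_tOrbit, add_sub_cancel]
      · rw [α.tProj_sigmaMap, map_add, B.tProj_tOrbit, add_zero]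
        exact hu.symm
    have e2 : ∀ (y : P) (a b : EP), q = y → a = b →
        (⟨q, a⟩ : TangentBundle 𝓘(ℝ, EP) P) = ⟨y, b⟩ := by
      rintro y a b rfl rfl; rfl
    refine e2 _ _ _ (B.act_one q).symm ?_
    refine Eq.trans e1 ?_
    exact congrArg (fun a : TangentSpace 𝓘(ℝ, EP) q => a + B.tOrbit q (α.form q w - α.form q u))
      (B.tAct_one q u).symm
  refine key _ _ (h' p hp) ?_
  have hsm : MDifferentiableAt 𝓘(ℝ, EM) 𝓘(ℝ, EP) s (B.proj p) :=
    (hs.contMDiffAt (hU.mem_nhds hp)).mdifferentiableAt (by simp)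
  set w' : TangentSpace 𝓘(ℝ, EM) (B.proj p) := A (B.proj p) (B.tProj p w) with hw'
  have f1 := mfderiv_comp_all (h := fun x : M => x) (B.mdifferentiableAt_proj (s (B.proj p))) hsm rfl
    (Filter.eventually_of_mem (hU.mem_nhds hp) fun y hy => (h y hy).symm) w'
  have f2 : (B.tProj (s (B.proj p)) (mfderiv 𝓘(ℝ, EM) 𝓘(ℝ, EP) s (B.proj p) w') : EM) = w' :=
    f1.symm.trans (congrArg (fun L : EM →L[ℝ] EM => L w')
      (mfderiv_id (I := 𝓘(ℝ, EM)) (x := B.proj p)))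
  have f3 : (mfderivWithin 𝓘(ℝ, EM) 𝓘(ℝ, EP) s U (B.proj p) : EM →L[ℝ] EP) =
      mfderiv 𝓘(ℝ, EM) 𝓘(ℝ, EP) s (B.proj p) := mfderivWithin_of_isOpen hU hp
  have f4 : ∀ D : TangentSpace 𝓘(ℝ, EP) (s (B.proj p)),
      (B.tProj (s (B.proj p)) D : EM) = w' →
      (B.tProj (B.act (s (B.proj p)) (γ p)) (B.tAct (γ p) (s (B.proj p)) D +
        mfderiv 𝓘(ℝ, EG) 𝓘(ℝ, EP) (B.act (s (B.proj p))) (γ p) 0) : EM) = w' := by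
    intro D hD
    rw [map_zero, add_zero]
    exact (B.tProj_tAct _ _ _).trans hD
  refine f4 (mfderivWithin 𝓘(ℝ, EM) 𝓘(ℝ, EP) s U (B.proj p) w') ?_
  exact Eq.trans (congrArg (fun L : EM →L[ℝ] EP => (B.tProj (s (B.proj p)) (L w') : EM)) f3) f2

theorem Conn.sigmaMap_mul_inv (A : TangentAut EM M) (p : P) (v : TangentSpace 𝓘(ℝ, EP) p) :
    α.sigmaMap A p (α.sigmaMap A⁻¹ p v) = v := by
  rw [← sigmaMap_mul, mul_inv_cancel, sigmaMap_one]

theorem Conn.sigmaMap_inv_mul (A : TangentAut EM M) (p : P) (v : TangentSpace 𝓘(ℝ, EP) p) :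
    α.sigmaMap A⁻¹ p (α.sigmaMap A p v) = v := by
  rw [← sigmaMap_mul, inv_mul_cancel, sigmaMap_one]

/-- `σ_α(Ã)` as an automorphism of `TP`. -/
def Conn.sigmaAut (A : TangentAut EM M) : TangentAut EP P where
  toFun p := LinearEquiv.ofLinearMap (α.sigmaMap A p) (α.sigmaMap A⁻¹ p)
    (LinearMap.ext fun v => α.sigmaMap_mul_inv A p v)
    (LinearMap.ext fun v => α.sigmaMap_inv_mul A p v)
  contMDiff_toFun := α.contMDiff_sigmaMap A
  contMDiff_invFun := α.contMDiff_sigmaMap A⁻¹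

theorem Conn.sigmaAut_mem (A : TangentAut EM M) : α.sigmaAut A ∈ B.autTG := by
  refine B.mem_autTG_of (fun p X => ?_) (fun g p v => ?_)
  · change α.sigmaMap A p _ = _
    rw [sigmaMap_apply, α.form_tOrbit, B.tProj_tOrbit, map_zero, map_zero, add_zero]
  · change α.sigmaMap A _ _ = B.tAct g p (α.sigmaMap A p v)
    rw [sigmaMap_apply, sigmaMap_apply, map_add, B.tAct_tOrbit, α.form_tAct]
    congr 1
    refine α.horLift_act g p _ _ ?_
    exact tangentAut_congr A (B.proj_act p g) (B.tProj_tAct g p v)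

/-- The group morphism `σ_α : Aut_0 TM → Aut_{TG} TP`. -/
def Conn.sigma : TangentAut EM M →* B.autTG where
  toFun A := ⟨α.sigmaAut A, α.sigmaAut_mem A⟩
  map_one' := Subtype.ext (TangentAut.ext_apply fun p v => α.sigmaMap_one p v)
  map_mul' A C := Subtype.ext (TangentAut.ext_apply fun p v => α.sigmaMap_mul A C p v)

end Sigma

end SmoothPrincipalBundle

end

/-! Fix a connection `α`. Since `Ker Tμ(p)` is the image of `Tκ_p(e)`, on which `α_p` inverts
`Tκ_p(e)`, a tangent vector `v` at `p` is determined by the pair `(α_p v, Tμ(p) v)`; this is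
`Conn.ext_vector`. Nearly every identity below between tangent vectors is checked by comparing these
two components.

Transitivity has an explicit witness. Two connections agree on vertical vectors, so `N = Tκ_p(e) ∘
(α_p - β_p)` kills vertical vectors and takes vertical values. Hence `N ∘ N = 0`, and the shear `1 +
N` is invertible with inverse `1 - N`. It does not change `Tμ`, so it lies in `Aut_N TP`, and `α ∘
(1 - N) = α - (α - β) = β`. This gives transitivity for `Aut_N TP`, and so for the larger group
`Aut_{TG} TP`.

The remaining claims are readings in components. An element of `Aut_N TP` preserves `Tμ`; if it also
preserves `α`, it preserves both components and is the identity. The stabilizer of `α` consists of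
the `A` with `α ∘ A = α`. Such an `A` acts only on the second component, where it acts by `λ(A)`,
and that is exactly `σ_α(λ(A))`. -/

namespace SmoothPrincipalBundle

/-! ### Vertical shears between two connections. -/

section Shear

variable {EG : Type*} [NormedAddCommGroup EG] [NormedSpace ℝ EG]
  {G : Type*} [TopologicalSpace G] [ChartedSpace EG G] [Group G]
  {EP : Type*} [NormedAddCommGroup EP] [NormedSpace ℝ EP]
  {P : Type*} [TopologicalSpace P] [ChartedSpace EP P] [IsManifold 𝓘(ℝ, EP) ∞ P]
  {EM : Type*} [NormedAddCommGroup EM] [NormedSpace ℝ EM]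
  {M : Type*} [TopologicalSpace M] [ChartedSpace EM M]
  {B : SmoothPrincipalBundle EG G EP P EM M}

/-- The vertical shear `v ↦ v + Tκ_p(e) (α v - β v)` of `T_p P` defined by two connections. -/
noncomputable def Conn.shearMap (α β : B.Conn) (p : P) :
    TangentSpace 𝓘(ℝ, EP) p →ₗ[ℝ] TangentSpace 𝓘(ℝ, EP) p :=
  LinearMap.id + (B.tOrbit p).toLinearMap ∘ₗ (α.form p - β.form p)

theorem Conn.shearMap_apply (α β : B.Conn) (p : P) (v : TangentSpace 𝓘(ℝ, EP) p) :
    α.shearMap β p v = v + B.tOrbit p (α.form p v - β.form p v) := rfl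

/-- The added vector is vertical, and every connection reads a vertical vector in the same way. The
third connection is left free because the inverse law needs it equal to either of the two that
define the shear. -/
theorem Conn.form_shearMap (α β γ : B.Conn) (p : P) (v : TangentSpace 𝓘(ℝ, EP) p) :
    γ.form p (α.shearMap β p v) = γ.form p v + (α.form p v - β.form p v) := by
  rw [shearMap_apply, map_add, γ.form_tOrbit]

theorem Conn.tProj_shearMap (α β : B.Conn) (p : P) (v : TangentSpace 𝓘(ℝ, EP) p) :
    B.tProj p (α.shearMap β p v) = B.tProj p v := by
  rw [shearMap_apply, map_add, B.tProj_tOrbit, add_zero]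

variable [LieGroup 𝓘(ℝ, EG) ∞ G]

/-- Exchanging the two connections changes the sign of the nilpotent part, so this is `(1 + N)(1 -
N) = 1` with `N ∘ N = 0`. -/
theorem Conn.shearMap_shearMap (α β : B.Conn) (p : P) (v : TangentSpace 𝓘(ℝ, EP) p) :
    α.shearMap β p (β.shearMap α p v) = v := by
  refine α.ext_vector _ ?_ ?_
  · simp only [form_shearMap]
    abel
  · simp only [tProj_shearMap]

/-- The tangent map of the action `P × G → P` sends `v` at `p` and `X` at `e` to `v + Tκ_p(e) X`.
The shear is its composite with the smooth map `v ↦ (v, (α - β) v)`, the second entry being placed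
in the fibre over `e`. -/
theorem Conn.contMDiff_shearMap (α β : B.Conn) :
    ContMDiff 𝓘(ℝ, EP).tangent 𝓘(ℝ, EP).tangent ∞
      (fun v : TangentBundle 𝓘(ℝ, EP) P =>
        (⟨v.1, α.shearMap β v.1 v.2⟩ : TangentBundle 𝓘(ℝ, EP) P)) := by
  have h := B.contMDiff_tangentAct.comp (contMDiff_id.prodMk
    ((contMDiff_fiber_one (G := G)).comp (α.contMDiff_form.sub β.contMDiff_form)))
  refine h.congr ?_
  rintro ⟨p, v⟩
  -- The composite lands over `p · e`, which equals `p` only propositionally. Comparing vectors in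
  -- the model space `EP` avoids a transport between fibres.
  have key : ∀ (y : P) (a b : EP), p = y → a = b →
      (⟨p, a⟩ : TangentBundle 𝓘(ℝ, EP) P) = ⟨y, b⟩ := by
    rintro y a b rfl rfl; rfl
  exact key _ _ _ (B.act_one p).symm
    (congrArg (fun a : TangentSpace 𝓘(ℝ, EP) p => a + B.tOrbit p (α.form p v - β.form p v))
      (B.tAct_one p v).symm)

/-- The vertical shear as an automorphism of `TP`. -/
noncomputable def Conn.shearAut (α β : B.Conn) : TangentAut EP P where
  toFun p := LinearEquiv.ofLinearMap (α.shearMap β p) (β.shearMap α p)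
    (LinearMap.ext fun v => α.shearMap_shearMap β p v)
    (LinearMap.ext fun v => β.shearMap_shearMap α p v)
  contMDiff_toFun := α.contMDiff_shearMap β
  contMDiff_invFun := β.contMDiff_shearMap α

theorem Conn.shearAut_mem_autTG (α β : B.Conn) : α.shearAut β ∈ B.autTG := by
  refine B.mem_autTG_of (fun p X => ?_) (fun g p v => ?_)
  · change α.shearMap β p _ = _
    -- Vertical vectors are fixed because `α` and `β` agree on them.
    rw [shearMap_apply, α.form_tOrbit, β.form_tOrbit, sub_self, map_zero, add_zero]
  · change α.shearMap β _ _ = B.tAct g p (α.shearMap β p v)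
    -- Equivariance: both forms pick up the same `Ad g⁻¹`, which is also the factor produced by
    -- moving `tAct` past `tOrbit`.
    rw [shearMap_apply, shearMap_apply, map_add, B.tAct_tOrbit, α.form_tAct, β.form_tAct, ← map_sub (Ad g⁻¹)]

theorem Conn.shearAut_mem_autN (α β : B.Conn) :
    (⟨α.shearAut β, α.shearAut_mem_autTG β⟩ : B.autTG) ∈ B.autN := by
  intro p v
  change B.tProj p (α.shearMap β p v - v) = 0
  rw [map_sub, tProj_shearMap, sub_self]

theorem Conn.shearAut_smul (α β : B.Conn) :
    (⟨α.shearAut β, α.shearAut_mem_autTG β⟩ : B.autTG) • α = β := by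
  refine Conn.ext_apply fun p v => ?_
  -- The action uses the inverse of the shear, which is by construction the shear with the
  -- connections exchanged.
  change α.form p (β.shearMap α p v) = β.form p v
  rw [form_shearMap, add_sub_cancel]

end Shear

/-! ### Freeness, horizontal lifts and stabilizers. -/

section Stabilizer

variable {EG : Type*} [NormedAddCommGroup EG] [NormedSpace ℝ EG]
  {G : Type*} [TopologicalSpace G] [ChartedSpace EG G] [Group G]
  {EP : Type*} [NormedAddCommGroup EP] [NormedSpace ℝ EP]
  {P : Type*} [TopologicalSpace P] [ChartedSpace EP P] [IsManifold 𝓘(ℝ, EP) ∞ P]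
  {EM : Type*} [NormedAddCommGroup EM] [NormedSpace ℝ EM]
  {M : Type*} [TopologicalSpace M] [ChartedSpace EM M]
  {B : SmoothPrincipalBundle EG G EP P EM M}

theorem smul_form_apply (A : B.autTG) (α : B.Conn) (p : P) (v : TangentSpace 𝓘(ℝ, EP) p) :
    (A • α).form p ((A : TangentAut EP P) p v) = α.form p v := by
  rw [smul_form, LinearEquiv.symm_apply_apply]

/-- Substituting `A(p) v` for the vector removes the inverse from the action, leaving a condition
that can be fed directly to `Conn.ext_vector`. -/
theorem smul_eq_iff (A : B.autTG) (α β : B.Conn) :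
    A • α = β ↔ ∀ (p : P) (v : TangentSpace 𝓘(ℝ, EP) p),
      β.form p ((A : TangentAut EP P) p v) = α.form p v := by
  constructor
  · rintro rfl p v
    exact smul_form_apply A α p v
  · intro h
    refine Conn.ext_apply fun p v => ?_
    rw [smul_form, ← h, LinearEquiv.apply_symm_apply]

variable [LieGroup 𝓘(ℝ, EG) ∞ G]

theorem Conn.eq_one_of_smul_eq (α : B.Conn) (A : B.autN) (h : A • α = α) : A = 1 := by
  have hA := (smul_eq_iff (A : B.autTG) α α).1 h
  refine Subtype.ext (Subtype.ext (TangentAut.ext_apply fun p v => ?_))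
  refine α.ext_vector p (hA p v) ?_
  -- Membership in `Aut_N TP` supplies the other component: `A(p)` preserves `Tμ(p)`.
  have h2 : B.tProj p (((A : B.autTG) : TangentAut EP P) p v - v) = 0 := A.2 p v
  rwa [map_sub, sub_eq_zero] at h2

variable [IsManifold 𝓘(ℝ, EM) ∞ M]

/-- `A(p)` carries `Ker α_p` into the kernel of the transformed form, so both sides are horizontal
for `A • α`; by the defining property of `λ` they have the same projection. -/
theorem apply_horLift (α : B.Conn) (A : B.autTG) (p : P)
    (w : TangentSpace 𝓘(ℝ, EM) (B.proj p)) :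
    (A : TangentAut EP P) p (α.horLift p w) = (A • α).horLift p (B.lambda A (B.proj p) w) := by
  refine (A • α).ext_vector p ?_ ?_
  · rw [smul_form_apply, α.form_horLift, Conn.form_horLift]
  · rw [← lambda_tProj, α.tProj_horLift, Conn.tProj_horLift]

theorem Conn.stabilizer_eq_range_sigma (α : B.Conn) :
    MulAction.stabilizer B.autTG α = α.sigma.range := by
  ext A
  rw [MulAction.mem_stabilizer_iff, smul_eq_iff]
  constructor
  · intro h
    -- No other preimage is possible: `σ_α(Ã)` covers `Ã` under `Tμ`, so `Ã` must be the map that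
    -- `A` induces on `TM`.
    refine ⟨B.lambda A, Subtype.ext (TangentAut.ext_apply fun p v => ?_)⟩
    change α.sigmaMap (B.lambda A) p v = _
    refine α.ext_vector p ?_ ?_
    · rw [α.form_sigmaMap, h]
    · rw [α.tProj_sigmaMap, lambda_tProj]
  · rintro ⟨C, rfl⟩ p v
    exact α.form_sigmaMap C p v

end Stabilizer

end SmoothPrincipalBundle

/-- Let `B` be a smooth principal `G`-bundle `P → M`.
(i) `Aut_{TG} TP` acts transitively on the connections by `φ_A(α) = α ∘ A⁻¹`.
(ii) `A(p) ∘ Γ_α(p) = Γ_{φ_A(α)}(p) ∘ λ(A)(μ(p))`.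
(iii) `Aut_N TP` acts freely and transitively on the connections.
(iv) The stabilizer of `α` in `Aut_{TG} TP` is `σ_α(Aut_0 TM)`. -/
theorem proposition3
    {EG : Type*} [NormedAddCommGroup EG] [NormedSpace ℝ EG] [FiniteDimensional ℝ EG]
    {G : Type*} [TopologicalSpace G] [ChartedSpace EG G] [Group G] [LieGroup 𝓘(ℝ, EG) ∞ G]
    {EP : Type*} [NormedAddCommGroup EP] [NormedSpace ℝ EP] [FiniteDimensional ℝ EP]
    {P : Type*} [TopologicalSpace P] [ChartedSpace EP P] [IsManifold 𝓘(ℝ, EP) ∞ P]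
    {EM : Type*} [NormedAddCommGroup EM] [NormedSpace ℝ EM] [FiniteDimensional ℝ EM]
    {M : Type*} [TopologicalSpace M] [ChartedSpace EM M] [IsManifold 𝓘(ℝ, EM) ∞ M]
    (B : SmoothPrincipalBundle EG G EP P EM M) :
    (∀ α β : B.Conn, ∃ A : B.autTG, A • α = β) ∧
    (∀ (α : B.Conn) (A : B.autTG) (p : P) (w : TangentSpace 𝓘(ℝ, EM) (B.proj p)),
      (A : TangentAut EP P) p (α.horLift p w) =
        (A • α).horLift p (B.lambda A (B.proj p) w)) ∧
    ((∀ (A : B.autN) (α : B.Conn), A • α = α → A = 1) ∧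
      (∀ α β : B.Conn, ∃ A : B.autN, A • α = β)) ∧
    (∀ α : B.Conn, MulAction.stabilizer B.autTG α = α.sigma.range) :=
  ⟨fun α β => ⟨_, α.shearAut_smul β⟩, SmoothPrincipalBundle.apply_horLift,
    ⟨fun A α => α.eq_one_of_smul_eq A,
      -- The subgroup acts by restriction, so the shear that proves the first claim serves again
      -- unchanged.
      fun α β => ⟨⟨_, α.shearAut_mem_autN β⟩, α.shearAut_smul β⟩⟩,
    fun α => α.stabilizer_eq_range_sigma⟩
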